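/- Let $m,d,n,s$ be natural numbers with $1\le s\le n$, and let $0<\gamma<1$, $\eta>0$, $\rho\in\mathbb R$. For $x\in\mathbb R^n$ and $T\subseteq\{1,\dots,n\}$ let $x_T$ be the vector that agrees with $x$ on $T$ and is zero elsewhere. A matrix $A$ with $n$ columns has the stable null space property (stable NSP) of order $s$ with constant $\gamma$ if $\|x_T\|_1<\gamma\|x_{T^c}\|_1$ for all $x\in\ker A\setminus\{0\}$ and all $T\subseteq\{1,\dots,n\}$ with $|T|\le s$. Put $$S_\gamma=\{x\in\mathbb R^n:\ \|x\|_2=1,\ \|x_T\|_1\ge\gamma\|x_{T^c}\|_1\text{ for some }T\text{ with }|T|\le s\},$$ and for a nonempty bounded set $S\subset\mathbb R^d$ let $w(S)=\mathbb E\sup_{z\in S}\langle g,z\rangle$, $g\sim N(0,I_d)$, be its Gaussian width. Let $D\in\mathbb R^{d\times n}$, with columns $d_1,\dots,d_n$, have the stable NSP of order $s$ with constant $\gamma$, with $\inf_{x\in S_\gamma}\|Dx\|_2\ge\eta$ and $\max_{1\le i\le n}\|d_i\|_2^2\le\rho$. Let $\Phi\in\mathbb R^{m\times d}$ be a random matrix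 whose rows are independent with distribution $N(0,I_d)$. If $$m\ \ge\ \frac{9\cdot 2^{15}\pi^3}{\eta^2}\,\frac{\rho}{\gamma^2}\,s\log\Bigl(\frac{\sqrt2\,n}{s}\Bigr),$$ then with probability at least $1-\exp\bigl(-\tfrac{m}{4^5\pi^2}\bigr)$ the matrix $\Phi D$ has the stable NSP of order $s$ with constant $\gamma$ and $$\inf_{x\in S_\gamma}\|\Phi Dx\|_2\ \ge\ w(DS_\gamma).$$ -/

import Mathlib

namespace StableNSP

open MeasureTheory ProbabilityTheory

/-- The matrix `A` has the stable null space property of order `s` with constant `γ`: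
`‖x_T‖₁ < γ ‖x_{Tᶜ}‖₁` for every `x ∈ ker A \ {0}` and every index set `T` with `|T| ≤ s`. -/
def HasStableNSP {m n : ℕ} (A : Matrix (Fin m) (Fin n) ℝ) (s : ℕ) (γ : ℝ) : Prop :=
  ∀ x : EuclideanSpace ℝ (Fin n), Matrix.toEuclideanLin A x = 0 → x ≠ 0 →
    ∀ T : Finset (Fin n), T.card ≤ s → ∑ i ∈ T, |x i| < γ * ∑ i ∈ Tᶜ, |x i|

/-- The set `S_γ` of Euclidean unit vectors that violate the stable null space property:
`‖x_T‖₁ ≥ γ ‖x_{Tᶜ}‖₁` for some index set `T` with `|T| ≤ s`, and `‖x‖₂ = 1`. -/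
def violationSet (n s : ℕ) (γ : ℝ) : Set (EuclideanSpace ℝ (Fin n)) :=
  {x | (∃ T : Finset (Fin n), T.card ≤ s ∧ γ * ∑ i ∈ Tᶜ, |x i| ≤ ∑ i ∈ T, |x i|) ∧ ‖x‖ = 1}

/-- `inf {‖A x‖₂ : x ∈ S}`, for a nonempty set `S`. -/
noncomputable def minNorm {m n : ℕ} (A : Matrix (Fin m) (Fin n) ℝ)
    (S : Set (EuclideanSpace ℝ (Fin n))) : ℝ :=
  ⨅ x : S, ‖Matrix.toEuclideanLin A (x : EuclideanSpace ℝ (Fin n))‖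

/-- The Gaussian width `w(S) = 𝔼 sup_{z ∈ S} ⟨g, z⟩`, `g ∼ N(0, I_d)`, of a nonempty bounded
set `S` (for which the integrand is integrable, see `integrable_gaussianWidth`). -/
noncomputable def gaussianWidth {d : ℕ} (S : Set (EuclideanSpace ℝ (Fin d))) : ℝ :=
  ∫ g, (⨆ z : S, inner ℝ g (z : EuclideanSpace ℝ (Fin d)))
    ∂(stdGaussian (EuclideanSpace ℝ (Fin d)))

theorem violationSet_nonempty {n s : ℕ} (γ : ℝ) (hs : 1 ≤ s) (hn : 1 ≤ n) :
    (violationSet n s γ).Nonempty := by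
  classical
  let i : Fin n := ⟨0, hn⟩
  refine ⟨EuclideanSpace.single i (1 : ℝ), ⟨{i}, by simpa using hs, ?_⟩, by simp⟩
  have h : ∑ j ∈ ({i} : Finset (Fin n))ᶜ, |(EuclideanSpace.single i (1 : ℝ)) j| = 0 := by
    refine Finset.sum_eq_zero fun j hj => ?_
    have : j ≠ i := by simpa using hj
    simp [this]
  rw [h]
  simp

theorem isBounded_image_violationSet {d n : ℕ} (D : Matrix (Fin d) (Fin n) ℝ) (s : ℕ) (γ : ℝ) :
    Bornology.IsBounded (Matrix.toEuclideanLin D '' violationSet n s γ) := by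
  have h : Bornology.IsBounded (violationSet n s γ) :=
    (Metric.isBounded_closedBall (x := 0) (r := 1)).subset fun x hx => by
      simpa using hx.2.le
  exact (LinearMap.toContinuousLinearMap (Matrix.toEuclideanLin D)).lipschitz.isBounded_image h

theorem integrable_gaussianWidth {d : ℕ} {S : Set (EuclideanSpace ℝ (Fin d))}
    (hne : S.Nonempty) (hb : Bornology.IsBounded S) :
    Integrable (fun g => ⨆ z : S, inner ℝ g (z : EuclideanSpace ℝ (Fin d)))
      (stdGaussian (EuclideanSpace ℝ (Fin d))) := by
  obtain ⟨C, hC⟩ := hb.exists_norm_le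
  have : Nonempty S := hne.to_subtype
  have key : ∀ (g : EuclideanSpace ℝ (Fin d)) (z : S),
      |inner ℝ g (z : EuclideanSpace ℝ (Fin d))| ≤ C * ‖g‖ := fun g z => by
    refine (abs_real_inner_le_norm _ _).trans ?_
    rw [mul_comm]
    exact mul_le_mul_of_nonneg_right (hC _ z.2) (norm_nonneg _)
  have hbdd : ∀ g : EuclideanSpace ℝ (Fin d),
      BddAbove (Set.range fun z : S => inner ℝ g (z : EuclideanSpace ℝ (Fin d))) := fun g =>
    ⟨C * ‖g‖, by rintro _ ⟨z, rfl⟩; exact (le_abs_self _).trans (key g z)⟩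
  have habs : ∀ g : EuclideanSpace ℝ (Fin d),
      |⨆ z : S, inner ℝ g (z : EuclideanSpace ℝ (Fin d))| ≤ C * ‖g‖ := fun g => by
    obtain ⟨z⟩ := ‹Nonempty S›
    rw [abs_le]
    exact ⟨(neg_le_of_abs_le (key g z)).trans (le_ciSup (hbdd g) z),
      ciSup_le fun z => (le_abs_self _).trans (key g z)⟩
  have hlip : LipschitzWith (Real.toNNReal C)
      (fun g => ⨆ z : S, inner ℝ g (z : EuclideanSpace ℝ (Fin d))) := by
    refine LipschitzWith.of_le_add_mul' C fun g h => ciSup_le fun z => ?_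
    have h1 : inner ℝ g (z : EuclideanSpace ℝ (Fin d)) = inner ℝ h (z : EuclideanSpace ℝ (Fin d))
        + inner ℝ (g - h) (z : EuclideanSpace ℝ (Fin d)) := by rw [inner_sub_left]; ring
    rw [h1, dist_eq_norm]
    exact add_le_add (le_ciSup (hbdd h) z) ((le_abs_self _).trans (key _ z))
  have hid : Integrable (fun g : EuclideanSpace ℝ (Fin d) => C * ‖g‖)
      (stdGaussian (EuclideanSpace ℝ (Fin d))) :=
    (IsGaussian.integrable_id (μ := stdGaussian (EuclideanSpace ℝ (Fin d)))).norm.const_mul C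
  exact hid.mono' hlip.continuous.aestronglyMeasurable (Filter.Eventually.of_forall habs)

end StableNSP

namespace StableNSP

open MeasureTheory ProbabilityTheory
open scoped NNReal

/-! Both conclusions follow once `√m η / 4` lies above the width `w(D S_γ)` and below `‖Φ D x‖` for
all `x ∈ S_γ`: a positive lower bound on `S_γ` already gives the stable NSP.

Everything rests on `‖x‖₁ ≤ R = 2√s/γ` on `S_γ`. For the width (`gaussianWidth_le_sqrt`), soft
thresholding splits `⟨g, Dx⟩` into a part paid for by `‖x‖₁`, a part paid for by `‖x‖₂ = 1`, and an
excess independent of `x` with an explicit expectation.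

For the lower bound (`one_sub_exp_le_measureReal`), Maurey's method approximates `x` by a mean of
`k` vectors `±R eᵢ`. There are at most `exp(4Lk)` such means, `L = log(√2 n/s)`. Chi-squared tails
and a union bound control `Φ` from below on the images of the means under `D` and from above on the
columns of `D`. The column bounds suffice for the approximation error, since Maurey's estimate
applies to `D` and `Φ D` simultaneously. -/

/-! ### Gaussian marginals and chi-squared tails. -/

theorem map_inner_stdGaussian {d : ℕ} (z : EuclideanSpace ℝ (Fin d)) :
    (stdGaussian (EuclideanSpace ℝ (Fin d))).map (fun g => inner ℝ g z) =
      gaussianReal 0 (‖z‖ ^ 2).toNNReal := by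
  have h : (fun g : EuclideanSpace ℝ (Fin d) => inner ℝ g z) = ⇑(innerSL ℝ z) := by
    ext g
    simp [real_inner_comm]
  rw [h, IsGaussian.map_eq_gaussianReal, integral_strongDual_stdGaussian,
    variance_dual_stdGaussian, innerSL_apply_norm]

theorem integral_exp_mul_sq_gaussianReal_zero_one {a : ℝ} (ha : 2 * a < 1) :
    ∫ x, Real.exp (a * x ^ 2) ∂(gaussianReal 0 1) = (Real.sqrt (1 - 2 * a))⁻¹ := by
  rw [integral_gaussianReal_eq_integral_smul one_ne_zero]
  have h : ∀ x : ℝ, gaussianPDFReal 0 1 x • Real.exp (a * x ^ 2) =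
      (Real.sqrt (2 * Real.pi))⁻¹ * Real.exp (-(1 / 2 - a) * x ^ 2) := fun x => by
    rw [gaussianPDFReal, smul_eq_mul, mul_assoc, ← Real.exp_add]
    congr 2 <;> simp <;> ring
  simp_rw [h]
  rw [integral_const_mul, integral_gaussian, ← Real.sqrt_inv, ← Real.sqrt_inv,
    ← Real.sqrt_mul (by positivity)]
  congr 1
  have : 1 - 2 * a ≠ 0 := by linarith
  have : 1 / 2 - a ≠ 0 := fun h => by apply this; linarith
  field_simp

theorem integral_exp_mul_sq_gaussianReal (v : ℝ≥0) {a : ℝ} (ha : 2 * (a * v) < 1) :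
    ∫ x, Real.exp (a * x ^ 2) ∂(gaussianReal 0 v) = (Real.sqrt (1 - 2 * (a * v)))⁻¹ := by
  have h : (gaussianReal 0 1).map (Real.sqrt v * ·) = gaussianReal 0 v := by
    rw [gaussianReal_map_const_mul]
    congr 1
    · simp
    · ext
      simp
  rw [← h, integral_map (by fun_prop) (by fun_prop),
    ← integral_exp_mul_sq_gaussianReal_zero_one ha]
  have h2 : ∀ x : ℝ, a * (Real.sqrt v * x) ^ 2 = a * v * x ^ 2 := fun x => by
    rw [mul_pow, Real.sq_sqrt v.coe_nonneg, mul_assoc]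
  simp_rw [h2]

section Chernoff

variable {m d : ℕ} {Ω : Type*} [MeasurableSpace Ω] {P : Measure Ω}
  {g : Fin m → Ω → EuclideanSpace ℝ (Fin d)}

theorem mgf_sum_inner_sq (hlaw : ∀ i, HasLaw (g i) (stdGaussian (EuclideanSpace ℝ (Fin d))) P)
    (hindep : iIndepFun g P) (z : EuclideanSpace ℝ (Fin d)) {a : ℝ} (ha : 2 * (a * ‖z‖ ^ 2) < 1) :
    mgf (fun ω => ∑ i, inner ℝ (g i ω) z ^ 2) P a =
      (Real.sqrt (1 - 2 * (a * ‖z‖ ^ 2)))⁻¹ ^ m := by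
  have hi : iIndepFun (fun i ω => inner ℝ (g i ω) z ^ 2) P :=
    hindep.comp (fun _ y => inner ℝ y z ^ 2) (fun _ => by fun_prop)
  have hm : ∀ i, AEMeasurable (fun ω => inner ℝ (g i ω) z ^ 2) P := fun i =>
    (by fun_prop : Measurable fun y : EuclideanSpace ℝ (Fin d) => inner ℝ y z ^ 2).comp_aemeasurable
      (hlaw i).aemeasurable
  have hs : (fun ω => ∑ i, inner ℝ (g i ω) z ^ 2) = ∑ i, fun ω => inner ℝ (g i ω) z ^ 2 := by
    ext ω
    simp
  rw [hs, hi.mgf_sum₀ hm]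
  have h1 : ∀ i, mgf (fun ω => inner ℝ (g i ω) z ^ 2) P a =
      (Real.sqrt (1 - 2 * (a * ‖z‖ ^ 2)))⁻¹ := fun i => by
    have hv : (((‖z‖ ^ 2).toNNReal : ℝ≥0) : ℝ) = ‖z‖ ^ 2 := Real.coe_toNNReal _ (by positivity)
    rw [← hv, ← integral_exp_mul_sq_gaussianReal _ (by rwa [hv]), ← map_inner_stdGaussian,
      integral_map (by fun_prop) (by fun_prop), ← (hlaw i).map_eq,
      integral_map (hlaw i).aemeasurable (by fun_prop), mgf]
  simp [h1]

theorem integrable_exp_sum_inner_sq [IsProbabilityMeasure P]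
    (hlaw : ∀ i, HasLaw (g i) (stdGaussian (EuclideanSpace ℝ (Fin d))) P)
    (hindep : iIndepFun g P) (z : EuclideanSpace ℝ (Fin d)) {a : ℝ} (ha : 2 * (a * ‖z‖ ^ 2) < 1) :
    Integrable (fun ω => Real.exp (a * ∑ i, inner ℝ (g i ω) z ^ 2)) P := by
  -- A non-integrable exponential would have `mgf` equal to the default value 0, so the positive
  -- closed form proves integrability.
  rw [← mgf_pos_iff, mgf_sum_inner_sq hlaw hindep z ha]
  have : 0 < 1 - 2 * (a * ‖z‖ ^ 2) := by linarith
  positivity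

/-- Lower tail of a chi-squared variable. -/
theorem measureReal_sum_inner_sq_lt_le [IsProbabilityMeasure P]
    (hlaw : ∀ i, HasLaw (g i) (stdGaussian (EuclideanSpace ℝ (Fin d))) P)
    (hindep : iIndepFun g P) (z : EuclideanSpace ℝ (Fin d)) :
    P.real {ω | ∑ i, inner ℝ (g i ω) z ^ 2 < m / 4 * ‖z‖ ^ 2} ≤ Real.exp (-(3 / 10 * m)) := by
  rcases eq_or_ne z 0 with rfl | hz
  · simp only [inner_zero_right, norm_zero]
    simp
    positivity
  have hz2 : 0 < ‖z‖ ^ 2 := by positivity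
  have ha : (-(3 / 2) / ‖z‖ ^ 2) * ‖z‖ ^ 2 = -(3 / 2) := by field_simp
  refine (measureReal_mono (μ := P) (s₂ := {ω | ∑ i, inner ℝ (g i ω) z ^ 2 ≤ m / 4 * ‖z‖ ^ 2})
    (Set.ofPred_subset_ofPred.2 fun ω hω => le_of_lt hω)).trans ?_
  -- This `t` makes the mgf exactly `4^(-m/2) = 2^(-m)`; the exponent is `3/8 - log 2 < -3/10` per
  -- row.
  refine (measure_le_le_exp_mul_mgf _ (t := -(3 / 2) / ‖z‖ ^ 2) ?_ ?_).trans ?_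
  · exact div_nonpos_of_nonpos_of_nonneg (by norm_num) hz2.le
  · exact integrable_exp_sum_inner_sq hlaw hindep z (by rw [ha]; norm_num)
  · rw [mgf_sum_inner_sq hlaw hindep z (by rw [ha]; norm_num), ha]
    have h4 : (Real.sqrt (1 - 2 * -(3 / 2)))⁻¹ = Real.exp (-Real.log 2) := by
      rw [show (1 - 2 * -(3 / 2) : ℝ) = 2 ^ 2 by norm_num, Real.sqrt_sq (by norm_num),
        Real.exp_neg, Real.exp_log (by norm_num)]
    rw [h4, ← Real.exp_nat_mul, ← Real.exp_add, Real.exp_le_exp]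
    have h5 : -(-(3 / 2) / ‖z‖ ^ 2) * (m / 4 * ‖z‖ ^ 2) = 3 / 8 * m := by
      field_simp
      ring
    rw [h5]
    have := Real.log_two_gt_d9
    nlinarith [Nat.cast_nonneg (α := ℝ) m]

/-- Upper tail of a chi-squared variable. -/
theorem measureReal_lt_sum_inner_sq_le [IsProbabilityMeasure P]
    (hlaw : ∀ i, HasLaw (g i) (stdGaussian (EuclideanSpace ℝ (Fin d))) P)
    (hindep : iIndepFun g P) (z : EuclideanSpace ℝ (Fin d)) {ρ : ℝ} (hρ : 0 < ρ)
    (hz : ‖z‖ ^ 2 ≤ ρ) :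
    P.real {ω | 4 * m * ρ < ∑ i, inner ℝ (g i ω) z ^ 2} ≤ Real.exp (-(7 / 10 * m)) := by
  have ha : 3 / 8 / ρ * ‖z‖ ^ 2 ≤ 3 / 8 := by
    rw [div_mul_eq_mul_div, div_le_iff₀ hρ]
    linarith
  refine (measureReal_mono (μ := P) (s₂ := {ω | 4 * m * ρ ≤ ∑ i, inner ℝ (g i ω) z ^ 2})
    (Set.ofPred_subset_ofPred.2 fun ω hω => le_of_lt hω)).trans ?_
  -- Here the mgf is at most `2^m`, and `-3/2 + log 2 < -7/10`.
  refine (measure_ge_le_exp_mul_mgf _ (t := 3 / 8 / ρ) (by positivity) ?_).trans ?_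
  · exact integrable_exp_sum_inner_sq hlaw hindep z (by linarith)
  · rw [mgf_sum_inner_sq hlaw hindep z (by linarith)]
    have h4 : (Real.sqrt (1 - 2 * (3 / 8 / ρ * ‖z‖ ^ 2)))⁻¹ ≤ Real.exp (Real.log 2) := by
      rw [Real.exp_log (by norm_num)]
      refine inv_le_of_inv_le₀ (by norm_num) (Real.le_sqrt_of_sq_le ?_)
      norm_num
      linarith
    calc _ ≤ Real.exp (-(3 / 8 / ρ) * (4 * m * ρ)) * Real.exp (Real.log 2) ^ m := by gcongr
      _ ≤ _ := by
        rw [← Real.exp_nat_mul, ← Real.exp_add, Real.exp_le_exp]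
        have h5 : -(3 / 8 / ρ) * (4 * m * ρ) = -(3 / 2) * m := by
          field_simp
          ring
        rw [h5]
        have := Real.log_two_lt_d9
        nlinarith [Nat.cast_nonneg (α := ℝ) m]

end Chernoff

/-! ### Maurey's method and the size of the net. -/

/-- Maurey's empirical method: a convex combination of vectors of norm at most `B` is within
`B / √k` of the mean of `k` of these vectors. -/
theorem exists_multiset_norm_sum_sub_sq_le {ι H : Type*} [Fintype ι] [NormedAddCommGroup H]
    [InnerProductSpace ℝ H] (v : ι → H) {p : ι → ℝ} (hp : ∀ i, 0 ≤ p i) (hp1 : ∑ i, p i = 1)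
    {C : ℝ} (hC : ∀ i, ‖v i‖ ^ 2 ≤ C) (k : ℕ) :
    ∃ t : Sym ι k, ‖(t.1.map fun i => v i - ∑ j, p j • v j).sum‖ ^ 2 ≤ k * C := by
  set x := ∑ j, p j • v j with hx
  induction k with
  | zero => exact ⟨Sym.nil, by simp⟩
  | succ k ih =>
    obtain ⟨t, ht⟩ := ih
    set S := (t.1.map fun i => v i - x).sum
    -- The vectors `v i - x` have `p`-mean zero, so the cross terms with `S` cancel on average; some
    -- index does no worse than the average, and it is added to the multiset.
    have hmean : ∑ i, p i * ‖v i - x + S‖ ^ 2 ≤ ∑ i, p i * (‖S‖ ^ 2 + C) := by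
      have h1 : ∀ i, p i * ‖v i - x + S‖ ^ 2 =
          p i * ‖v i‖ ^ 2 + (2 * inner ℝ (p i • v i) (S - x)) + p i * ‖S - x‖ ^ 2 := fun i => by
        rw [show v i - x + S = v i + (S - x) by abel, norm_add_sq_real, real_inner_smul_left]
        ring
      simp_rw [h1, Finset.sum_add_distrib, ← Finset.mul_sum, ← Finset.sum_mul, ← sum_inner, ← hx,
        hp1]
      have h2 : ∑ i, p i * ‖v i‖ ^ 2 ≤ C := by
        calc _ ≤ ∑ i, p i * C := by
              gcongr with i
              · exact hp i
              · exact hC i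
          _ = C := by rw [← Finset.sum_mul, hp1, one_mul]
      rw [norm_sub_sq_real, inner_sub_right, real_inner_comm S x, real_inner_self_eq_norm_sq]
      nlinarith [sq_nonneg ‖x‖]
    obtain ⟨i, hi, hle⟩ : ∃ i, 0 < p i ∧ ‖v i - x + S‖ ^ 2 ≤ ‖S‖ ^ 2 + C := by
      by_contra! hcon
      have hne : ∃ i, 0 < p i := by
        by_contra! h
        have : ∑ i, p i ≤ 0 := Finset.sum_nonpos fun i _ => h i
        linarith
      obtain ⟨i, hi⟩ := hne
      refine hmean.not_gt (Finset.sum_lt_sum (fun j _ => ?_) ⟨i, Finset.mem_univ _, ?_⟩)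
      · rcases (hp j).eq_or_lt with h | h
        · simp [← h]
        · exact mul_le_mul_of_nonneg_left (hcon j h).le (hp j)
      · exact mul_lt_mul_of_pos_left (hcon i hi) hi
    refine ⟨i ::ₛ t, ?_⟩
    have : ((i ::ₛ t : Sym ι (k + 1)).1.map fun i => v i - x).sum = v i - x + S := by
      rw [Sym.val_eq_coe, Sym.coe_cons, Multiset.map_cons, Multiset.sum_cons, ← Sym.val_eq_coe]
    rw [this]
    push_cast
    linarith

/-- Uses `k! ≥ (k/e)^k`. Counting multisets instead of sequences gains the factor `k!`, which is
what yields `log(n/s)` rather than `log n`. -/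
theorem card_sym_le {ι : Type*} [Fintype ι] [DecidableEq ι] {k : ℕ} (hk : 0 < k) :
    (Fintype.card (Sym ι k) : ℝ) ≤ (Real.exp 1 * ((Fintype.card ι + k) / k)) ^ k := by
  rw [Sym.card_sym_eq_choose]
  have hk0 : (0 : ℝ) < k := by exact_mod_cast hk
  calc ((Fintype.card ι + k - 1).choose k : ℝ) ≤ ((Fintype.card ι + k).choose k : ℝ) := by
        exact_mod_cast Nat.choose_le_choose k (Nat.sub_le _ _)
    _ ≤ ((Fintype.card ι + k : ℕ) : ℝ) ^ k / k.factorial := Nat.choose_le_pow_div _ _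
    _ ≤ ((Fintype.card ι + k : ℕ) : ℝ) ^ k * (Real.exp k / k ^ k) := by
        rw [div_eq_mul_inv]
        gcongr
        rw [inv_le_comm₀ (by positivity) (by positivity), inv_div, div_le_iff₀ (by positivity)]
        have := Real.pow_div_factorial_le_exp (x := k) hk0.le k
        rw [div_le_iff₀ (by positivity)] at this
        linarith
    _ = _ := by
        rw [← Real.exp_one_pow, mul_pow, div_pow]
        push_cast
        ring

section Violation

variable {n s : ℕ} {γ : ℝ} {x : EuclideanSpace ℝ (Fin n)}

/-- Cauchy–Schwarz bounds the part on `T` by `√s`, the violation bounds the rest by `√s/γ`, and `1 +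
1/γ ≤ 2/γ`. -/
theorem sum_abs_le_of_mem_violationSet (hγ0 : 0 < γ) (hγ1 : γ < 1)
    (hx : x ∈ violationSet n s γ) : ∑ i, |x i| ≤ 2 * Real.sqrt s / γ := by
  obtain ⟨⟨T, hT, hle⟩, hn⟩ := hx
  have h1 : ∑ i ∈ T, |x i| ≤ Real.sqrt s := by
    refine Real.le_sqrt_of_sq_le ?_
    calc (∑ i ∈ T, |x i|) ^ 2 ≤ T.card * ∑ i ∈ T, |x i| ^ 2 := sq_sum_le_card_mul_sum_sq
      _ ≤ s * ∑ i, |x i| ^ 2 := by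
        gcongr
        exact Finset.subset_univ T
      _ = s := by
        have h := EuclideanSpace.real_norm_sq_eq x
        rw [hn] at h
        simp only [sq_abs]
        rw [← h]
        simp
  have h0 : 0 ≤ ∑ i ∈ T, |x i| := by positivity
  rw [← Finset.sum_add_sum_compl T, le_div_iff₀ hγ0]
  nlinarith

/-- A vector of `ℓ¹`-norm at most `R` is a convex combination of the vectors `± R eᵢ`. -/
theorem exists_convex_weights (hn : 0 < n) {R : ℝ} (hR : 0 < R) (hx : ∑ i, |x i| ≤ R) :
    ∃ p : Fin n × Bool → ℝ, (∀ i, 0 ≤ p i) ∧ ∑ i, p i = 1 ∧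
      ∑ i, p i • EuclideanSpace.single i.1 (if i.2 then R else -R) = x := by
  have hn' : (0 : ℝ) < n := by exact_mod_cast hn
  -- Positive and negative parts of `x` divided by `R`; the leftover mass is spread evenly over all
  -- `2n` points, where it cancels in pairs `±R eᵢ`.
  refine ⟨fun i => (|x i.1| + (if i.2 then x i.1 else -x i.1)) / (2 * R) +
    (1 - (∑ j, |x j|) / R) / (2 * n), fun i => ?_, ?_, ?_⟩
  · have h1 : 0 ≤ 1 - (∑ j, |x j|) / R := by
      rw [sub_nonneg, div_le_one hR]
      exact hx
    have h2 : 0 ≤ |x i.1| + (if i.2 then x i.1 else -x i.1) := by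
      split_ifs
      · linarith [neg_abs_le (x i.1)]
      · linarith [le_abs_self (x i.1)]
    positivity
  · rw [Fintype.sum_prod_type]
    simp only [Fintype.sum_bool, if_true, Bool.false_eq_true, if_false]
    have : ∀ i, (|x i| + x i) / (2 * R) + (1 - (∑ j, |x j|) / R) / (2 * n) +
        ((|x i| + -x i) / (2 * R) + (1 - (∑ j, |x j|) / R) / (2 * n)) =
        |x i| / R + (1 - (∑ j, |x j|) / R) / n := fun i => by
      field_simp
      ring
    simp_rw [this, Finset.sum_add_distrib, ← Finset.sum_div]
    simp
    field_simp
    ring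
  · rw [Fintype.sum_prod_type]
    ext l
    simp only [Fintype.sum_bool, if_true, Bool.false_eq_true, if_false]
    simp only [WithLp.ofLp_sum, WithLp.ofLp_add, WithLp.ofLp_smul, Finset.sum_apply, Pi.add_apply,
      Pi.smul_apply, PiLp.single_apply, smul_eq_mul]
    rw [Finset.sum_eq_single l]
    · simp
      field_simp
      ring
    · intro b _ hb
      simp [hb.symm]
    · simp

end Violation

theorem toEuclideanLin_single {m n : ℕ} (A : Matrix (Fin m) (Fin n) ℝ) (j : Fin n) (a : ℝ) :
    Matrix.toEuclideanLin A (EuclideanSpace.single j a) = a • WithLp.toLp 2 (A.col j) := by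
  ext i
  simp [Matrix.toEuclideanLin, Matrix.toLpLin_apply, Matrix.mulVec_single]

theorem toEuclideanLin_apply_eq_sum {m n : ℕ} (A : Matrix (Fin m) (Fin n) ℝ)
    (x : EuclideanSpace ℝ (Fin n)) :
    Matrix.toEuclideanLin A x = ∑ j, x j • WithLp.toLp 2 (A.col j) := by
  ext i
  simp [Matrix.toEuclideanLin, Matrix.toLpLin_apply, Matrix.mulVec, dotProduct, mul_comm]

theorem norm_sq_toEuclideanLin {m d : ℕ} (A : Matrix (Fin m) (Fin d) ℝ)
    (z : EuclideanSpace ℝ (Fin d)) :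
    ‖Matrix.toEuclideanLin A z‖ ^ 2 =
      ∑ i, inner ℝ (WithLp.toLp 2 (A.row i) : EuclideanSpace ℝ (Fin d)) z ^ 2 := by
  rw [EuclideanSpace.real_norm_sq_eq]
  refine Finset.sum_congr rfl fun i _ => ?_
  simp [Matrix.toEuclideanLin, Matrix.toLpLin_apply, Matrix.mulVec, dotProduct, PiLp.inner_apply,
    mul_comm]

theorem toEuclideanLin_mul_apply {m d n : ℕ} (A : Matrix (Fin m) (Fin d) ℝ)
    (B : Matrix (Fin d) (Fin n) ℝ) (x : EuclideanSpace ℝ (Fin n)) :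
    Matrix.toEuclideanLin (A * B) x = Matrix.toEuclideanLin A (Matrix.toEuclideanLin B x) := by
  ext i
  simp [Matrix.toEuclideanLin, Matrix.toLpLin_apply]

theorem minNorm_le {m n : ℕ} (A : Matrix (Fin m) (Fin n) ℝ) {S : Set (EuclideanSpace ℝ (Fin n))}
    {x : EuclideanSpace ℝ (Fin n)} (hx : x ∈ S) :
    minNorm A S ≤ ‖Matrix.toEuclideanLin A x‖ :=
  ciInf_le (f := fun x : S => ‖Matrix.toEuclideanLin A (x : EuclideanSpace ℝ (Fin n))‖)
    ⟨0, by rintro _ ⟨y, rfl⟩; exact norm_nonneg _⟩ ⟨x, hx⟩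

/-! ### Upper bound for the Gaussian width. -/

/-- Soft thresholding at level `t`. -/
theorem mul_le_soft_threshold (h a : ℝ) {t lam c : ℝ} (hlam : 0 < lam) (hc : 0 < c) :
    a * h ≤ t * |a| + c / 2 * a ^ 2 +
      Real.exp (-(lam * t)) / (c * lam ^ 2) * (Real.exp (lam * h) + Real.exp (-lam * h)) := by
  have hE : Real.exp (lam * (|h| - t)) ≤
      Real.exp (-(lam * t)) * (Real.exp (lam * h) + Real.exp (-lam * h)) := by
    rw [show lam * (|h| - t) = -(lam * t) + lam * |h| by ring, Real.exp_add]
    gcongr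
    rcases abs_cases h with ⟨h1, -⟩ | ⟨h1, -⟩ <;> rw [h1]
    · linarith [Real.exp_pos (-lam * h)]
    · rw [mul_neg, ← neg_mul]
      linarith [Real.exp_pos (lam * h)]
  have h0 : a * h ≤ |a| * |h| := (le_abs_self _).trans (abs_mul a h).le
  -- Young's inequality with weight `c`, then `u²/2 ≤ exp(λu)/λ²` for `u ≥ 0`, so that only Gaussian
  -- exponential moments remain.
  have h1 : |a| * (|h| - t) ≤ c / 2 * a ^ 2 + Real.exp (lam * (|h| - t)) / (c * lam ^ 2) := by
    rcases le_total (|h| - t) 0 with hu | hu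
    · have : |a| * (|h| - t) ≤ 0 := mul_nonpos_of_nonneg_of_nonpos (abs_nonneg a) hu
      have : 0 ≤ c / 2 * a ^ 2 + Real.exp (lam * (|h| - t)) / (c * lam ^ 2) := by positivity
      linarith
    · have hq := Real.quadratic_le_exp_of_nonneg (mul_nonneg hlam.le hu)
      have h2 : |a| * (|h| - t) ≤ c / 2 * a ^ 2 + (|h| - t) ^ 2 / (2 * c) := by
        rw [← sq_abs a]
        have : c / 2 * |a| ^ 2 + (|h| - t) ^ 2 / (2 * c) - |a| * (|h| - t) =
            (c * |a| - (|h| - t)) ^ 2 / (2 * c) := by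
          field_simp
          ring
        have : 0 ≤ (c * |a| - (|h| - t)) ^ 2 / (2 * c) := by positivity
        linarith
      have h3 : (|h| - t) ^ 2 / (2 * c) ≤ Real.exp (lam * (|h| - t)) / (c * lam ^ 2) := by
        rw [div_le_div_iff₀ (by positivity) (by positivity)]
        have : lam * (|h| - t) ≥ 0 := mul_nonneg hlam.le hu
        have h4 : (lam * (|h| - t)) ^ 2 / 2 ≤ Real.exp (lam * (|h| - t)) := by linarith
        nlinarith
      linarith
  have h2 : Real.exp (lam * (|h| - t)) / (c * lam ^ 2) ≤
      Real.exp (-(lam * t)) / (c * lam ^ 2) * (Real.exp (lam * h) + Real.exp (-lam * h)) := by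
    rw [div_mul_eq_mul_div]
    gcongr
  nlinarith

theorem integrable_exp_mul_inner_stdGaussian {d : ℕ} (z : EuclideanSpace ℝ (Fin d)) (lam : ℝ) :
    Integrable (fun g : EuclideanSpace ℝ (Fin d) => Real.exp (lam * inner ℝ g z))
      (stdGaussian (EuclideanSpace ℝ (Fin d))) := by
  have : Integrable (fun y : ℝ => Real.exp (lam * y))
      ((stdGaussian (EuclideanSpace ℝ (Fin d))).map fun g => inner ℝ g z) := by
    rw [map_inner_stdGaussian]
    exact integrable_exp_mul_gaussianReal lam
  exact this.comp_measurable (by fun_prop)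

theorem integral_exp_mul_inner_stdGaussian {d : ℕ} (z : EuclideanSpace ℝ (Fin d)) (lam : ℝ) :
    ∫ g, Real.exp (lam * inner ℝ g z) ∂(stdGaussian (EuclideanSpace ℝ (Fin d))) =
      Real.exp (‖z‖ ^ 2 * lam ^ 2 / 2) := by
  have := mgf_gaussianReal (map_inner_stdGaussian z) lam
  rw [mgf] at this
  rw [this, Real.coe_toNNReal _ (by positivity)]
  simp

theorem gaussianWidth_le {d n s : ℕ} {γ ρ t lam c : ℝ} (hs : 1 ≤ s) (hsn : s ≤ n)
    (hγ0 : 0 < γ) (hγ1 : γ < 1) (D : Matrix (Fin d) (Fin n) ℝ)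
    (hDρ : ∀ j : Fin n, ‖(WithLp.toLp 2 (D.col j) : EuclideanSpace ℝ (Fin d))‖ ^ 2 ≤ ρ)
    (ht : 0 ≤ t) (hlam : 0 < lam) (hc : 0 < c) :
    gaussianWidth (Matrix.toEuclideanLin D '' violationSet n s γ) ≤
      t * (2 * Real.sqrt s / γ) + c / 2 +
        Real.exp (-(lam * t)) / (c * lam ^ 2) * (n * (2 * Real.exp (ρ * lam ^ 2 / 2))) := by
  set dc : Fin n → EuclideanSpace ℝ (Fin d) := fun j => WithLp.toLp 2 (D.col j)
  have hne := (violationSet_nonempty γ hs (hs.trans hsn)).image (Matrix.toEuclideanLin D)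
  have hint := integrable_gaussianWidth hne (isBounded_image_violationSet D s γ)
  have : Nonempty (Matrix.toEuclideanLin D '' violationSet n s γ) := hne.to_subtype
  have hint2 : ∀ j, Integrable (fun g : EuclideanSpace ℝ (Fin d) =>
      Real.exp (lam * inner ℝ g (dc j)) + Real.exp (-lam * inner ℝ g (dc j)))
      (stdGaussian (EuclideanSpace ℝ (Fin d))) := fun j =>
    (integrable_exp_mul_inner_stdGaussian _ _).add (integrable_exp_mul_inner_stdGaussian _ _)
  have hint3 := (integrable_finsetSum Finset.univ fun j _ => hint2 j).const_mul
    (Real.exp (-(lam * t)) / (c * lam ^ 2))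
  calc gaussianWidth (Matrix.toEuclideanLin D '' violationSet n s γ)
      ≤ ∫ g, (t * (2 * Real.sqrt s / γ) + c / 2 + Real.exp (-(lam * t)) / (c * lam ^ 2) *
          ∑ j, (Real.exp (lam * inner ℝ g (dc j)) + Real.exp (-lam * inner ℝ g (dc j))))
          ∂(stdGaussian (EuclideanSpace ℝ (Fin d))) := by
        refine integral_mono hint ((integrable_const _).add hint3) fun g => ciSup_le ?_
        rintro ⟨_, x, hx, rfl⟩
        change inner ℝ g (Matrix.toEuclideanLin D x) ≤ _
        rw [toEuclideanLin_apply_eq_sum, inner_sum]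
        calc ∑ j, inner ℝ g (x j • dc j)
            ≤ ∑ j, (t * |x j| + c / 2 * x j ^ 2 + Real.exp (-(lam * t)) / (c * lam ^ 2) *
              (Real.exp (lam * inner ℝ g (dc j)) + Real.exp (-lam * inner ℝ g (dc j)))) := by
              refine Finset.sum_le_sum fun j _ => ?_
              rw [real_inner_smul_right]
              exact mul_le_soft_threshold _ _ hlam hc
          _ ≤ _ := by
              rw [Finset.sum_add_distrib, Finset.sum_add_distrib, ← Finset.mul_sum,
                ← Finset.mul_sum, ← Finset.mul_sum, ← EuclideanSpace.real_norm_sq_eq, hx.2]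
              have := mul_le_mul_of_nonneg_left (sum_abs_le_of_mem_violationSet hγ0 hγ1 hx) ht
              linarith
    _ = t * (2 * Real.sqrt s / γ) + c / 2 + Real.exp (-(lam * t)) / (c * lam ^ 2) *
          ∑ j, (2 * Real.exp (‖dc j‖ ^ 2 * lam ^ 2 / 2)) := by
        rw [integral_add (integrable_const _) hint3, integral_const_mul,
          integral_finsetSum _ fun j _ => hint2 j]
        congr 2
        · simp
        · refine Finset.sum_congr rfl fun j _ => ?_
          rw [integral_add (integrable_exp_mul_inner_stdGaussian _ _)
            (integrable_exp_mul_inner_stdGaussian _ _), integral_exp_mul_inner_stdGaussian,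
            integral_exp_mul_inner_stdGaussian, neg_sq]
          ring
    _ ≤ _ := by
        gcongr
        calc _ ≤ ∑ j : Fin n, (2 * Real.exp (ρ * lam ^ 2 / 2)) := by
              gcongr with j
              exact hDρ j
          _ = _ := by simp

/-- The width of `D S_γ` is of the order of `√(ρ s log (n / s)) / γ`. -/
theorem gaussianWidth_le_sqrt {d n s : ℕ} {γ ρ L : ℝ} (hs : 1 ≤ s) (hsn : s ≤ n)
    (hγ0 : 0 < γ) (hγ1 : γ < 1) (hρ : 0 < ρ) (hL : 1 / 3 ≤ L)
    (hLn : Real.exp (-L) * n ≤ s) (D : Matrix (Fin d) (Fin n) ℝ)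
    (hDρ : ∀ j : Fin n, ‖(WithLp.toLp 2 (D.col j) : EuclideanSpace ℝ (Fin d))‖ ^ 2 ≤ ρ) :
    gaussianWidth (Matrix.toEuclideanLin D '' violationSet n s γ) ≤
      13 * Real.sqrt (ρ * s * L) / γ := by
  have hs0 : (0 : ℝ) < s := by exact_mod_cast hs
  have hL0 : 0 < L := by linarith
  set t := Real.sqrt (2 * ρ * L)
  have ht : 0 < t := by positivity
  have ht2 : t ^ 2 = 2 * ρ * L := Real.sq_sqrt (by positivity)
  set G := Real.sqrt (ρ * s * L)
  have hG : 0 < G := by positivity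
  have hG2 : G ^ 2 = ρ * s * L := Real.sq_sqrt (by positivity)
  refine (gaussianWidth_le hs hsn hγ0 hγ1 D hDρ ht.le (lam := t / ρ) (by positivity)
    (c := 2 * G) (by positivity)).trans ?_
  have h1 : t * (2 * Real.sqrt s / γ) ≤ 3 * G / γ := by
    rw [← mul_div_assoc]
    refine div_le_div_of_nonneg_right ?_ hγ0.le
    have : t * Real.sqrt s ≤ 3 / 2 * G := by
      refine le_of_sq_le_sq ?_ (by positivity)
      rw [mul_pow, mul_pow, ht2, hG2, Real.sq_sqrt hs0.le]
      have : 0 < ρ * s * L := by positivity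
      nlinarith
    linarith
  -- The threshold gives `exp(-2L)` and the moments `exp(L)`, so the sum over `n` columns costs only
  -- `exp(-L) n ≤ s`.
  have h2 : Real.exp (-(t / ρ * t)) / (2 * G * (t / ρ) ^ 2) *
      (n * (2 * Real.exp (ρ * (t / ρ) ^ 2 / 2))) ≤ 9 * G := by
    have e1 : t / ρ * t = 2 * L := by
      rw [div_mul_eq_mul_div, ← sq, ht2]
      field_simp
    have e2 : ρ * (t / ρ) ^ 2 / 2 = L := by
      rw [div_pow, ht2]
      field_simp
    have e3 : (t / ρ) ^ 2 = 2 * L / ρ := by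
      rw [div_pow, ht2]
      field_simp
    rw [e1, e2, e3]
    have e4 : Real.exp (-(2 * L)) / (2 * G * (2 * L / ρ)) * (n * (2 * Real.exp L)) =
        (Real.exp (-L) * n) * (ρ / (2 * G * L)) := by
      rw [show Real.exp (-(2 * L)) = Real.exp (-L) * Real.exp (-L) by
        rw [← Real.exp_add]; ring_nf, Real.exp_neg]
      field_simp
    rw [e4]
    calc _ ≤ s * (ρ / (2 * G * L)) := by gcongr
      _ ≤ 9 * G := by
        rw [← mul_div_assoc, div_le_iff₀ (by positivity)]
        have h3 : 9 * G * (2 * G * L) = 18 * L ^ 2 * (s * ρ) := by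
          calc _ = 18 * G ^ 2 * L := by ring
            _ = _ := by rw [hG2]; ring
        rw [h3]
        have : 1 ≤ 18 * L ^ 2 := by nlinarith
        have : 0 < s * ρ := by positivity
        nlinarith
  have h3 : 10 * G ≤ 10 * G / γ := by
    rw [le_div_iff₀ hγ0]
    nlinarith
  have h4 : 13 * G / γ = 3 * G / γ + 10 * G / γ := by ring
  rw [h4]
  linarith

/-! ### Lower bound for `‖Φ D x‖` on `S_γ` by a net. -/

/-- The mean of the signed coordinate vectors `± R eᵢ` listed by `t`. -/
noncomputable def netPoint {n : ℕ} (R : ℝ) {k : ℕ} (t : Sym (Fin n × Bool) k) :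
    EuclideanSpace ℝ (Fin n) :=
  (k : ℝ)⁻¹ • (t.1.map fun i => EuclideanSpace.single i.1 (if i.2 then R else -R)).sum

/-- Maurey's empirical method for two linear maps at once. -/
theorem exists_netPoint_close {n : ℕ} {H₁ H₂ : Type*} [NormedAddCommGroup H₁]
    [InnerProductSpace ℝ H₁] [NormedAddCommGroup H₂] [InnerProductSpace ℝ H₂]
    (F : EuclideanSpace ℝ (Fin n) →ₗ[ℝ] H₁) (G : EuclideanSpace ℝ (Fin n) →ₗ[ℝ] H₂)
    (hn : 0 < n) {R ρ : ℝ} (hR : 0 < R) {k : ℕ} (hk : 0 < k)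
    (hF : ∀ j, ‖F (EuclideanSpace.single j 1)‖ ^ 2 ≤ ρ)
    (hG : ∀ j, ‖G (EuclideanSpace.single j 1)‖ ^ 2 ≤ ρ)
    {x : EuclideanSpace ℝ (Fin n)} (hx : ∑ i, |x i| ≤ R) :
    ∃ t : Sym (Fin n × Bool) k,
      ‖F (netPoint R t - x)‖ ^ 2 + ‖G (netPoint R t - x)‖ ^ 2 ≤ 2 * R ^ 2 * ρ / k := by
  obtain ⟨p, hp, hp1, hpx⟩ := exists_convex_weights hn hR hx
  have hk0 : (0 : ℝ) < k := by exact_mod_cast hk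
  let e : Fin n × Bool → EuclideanSpace ℝ (Fin n) :=
    fun i => EuclideanSpace.single i.1 (if i.2 then R else -R)
  -- In the `ℓ²` product the squared norms add, so one choice of net point serves both maps.
  let K : EuclideanSpace ℝ (Fin n) →ₗ[ℝ] WithLp 2 (H₁ × H₂) :=
    (WithLp.linearEquiv 2 ℝ (H₁ × H₂)).symm.toLinearMap ∘ₗ F.prod G
  have hK : ∀ u, ‖K u‖ ^ 2 = ‖F u‖ ^ 2 + ‖G u‖ ^ 2 := fun u =>
    WithLp.prod_norm_sq_eq_of_L2 _
  have he : ∀ i, ‖K (e i)‖ ^ 2 ≤ 2 * R ^ 2 * ρ := fun i => by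
    have h1 : e i = (if i.2 then R else -R) • EuclideanSpace.single i.1 (1 : ℝ) := by
      ext j
      simp only [e, PiLp.single_apply, PiLp.smul_apply, smul_eq_mul, mul_ite, mul_one, mul_zero]
    have h2 : ‖(if i.2 then R else -R : ℝ)‖ ^ 2 = R ^ 2 := by
      split_ifs <;> simp
    rw [hK, h1, map_smul, map_smul, norm_smul, norm_smul, mul_pow, mul_pow, h2]
    nlinarith [hF i.1, hG i.1, sq_nonneg R]
  obtain ⟨t, ht⟩ := exists_multiset_norm_sum_sub_sq_le (fun i => K (e i)) hp hp1 he k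
  refine ⟨t, ?_⟩
  have hsum : (t.1.map fun i => K (e i) - ∑ j, p j • K (e j)).sum =
      (k : ℝ) • K (netPoint R t - x) := by
    have h1 : ∑ j, p j • K (e j) = K x := by
      rw [← hpx, map_sum]
      simp [e]
    rw [h1, Multiset.sum_map_sub, ← map_smul, smul_sub, netPoint, smul_inv_smul₀ hk0.ne', map_sub,
      map_multiset_sum, Multiset.map_map]
    congr 1
    simp [Nat.cast_smul_eq_nsmul]
  rw [hsum, norm_smul, mul_pow, hK] at ht
  rw [le_div_iff₀ hk0]
  simp only [Real.norm_natCast] at ht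
  refine le_of_mul_le_mul_left ?_ hk0
  linarith

/-- Small-ball bounds on a net and norm bounds on the columns give a lower bound. -/
theorem sqrt_mul_le_norm_of_net {m d n k : ℕ} (A : Matrix (Fin m) (Fin d) ℝ)
    (D : Matrix (Fin d) (Fin n) ℝ) (hn : 0 < n) (hm : 0 < m) (hk : 0 < k) {R ρ η : ℝ} (hR : 0 < R)
    (hη : 0 < η) (hkR : 200 * R ^ 2 * ρ ≤ k * η ^ 2)
    (hDρ : ∀ j : Fin n, ‖(WithLp.toLp 2 (D.col j) : EuclideanSpace ℝ (Fin d))‖ ^ 2 ≤ ρ)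
    (hA : ∀ j : Fin n, ‖Matrix.toEuclideanLin A (WithLp.toLp 2 (D.col j))‖ ^ 2 ≤ 4 * m * ρ)
    (hnet : ∀ t : Sym (Fin n × Bool) k, m / 4 * ‖Matrix.toEuclideanLin D (netPoint R t)‖ ^ 2 ≤
      ‖Matrix.toEuclideanLin A (Matrix.toEuclideanLin D (netPoint R t))‖ ^ 2)
    {x : EuclideanSpace ℝ (Fin n)} (hx : ∑ i, |x i| ≤ R)
    (hxη : η ≤ ‖Matrix.toEuclideanLin D x‖) :
    Real.sqrt m * η / 4 ≤ ‖Matrix.toEuclideanLin (A * D) x‖ := by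
  set F := Matrix.toEuclideanLin D
  set B := Matrix.toEuclideanLin A
  have hm0 : (0 : ℝ) < m := by exact_mod_cast hm
  have hk0 : (0 : ℝ) < k := by exact_mod_cast hk
  set q := Real.sqrt m
  have hq : 0 < q := by positivity
  have hq2 : q ^ 2 = m := Real.sq_sqrt hm0.le
  -- Scaling by `1/(2√m)` brings the column bound `4mρ` down to `ρ`, as for `D`.
  obtain ⟨t, ht⟩ := exists_netPoint_close F ((2 * q)⁻¹ • (B ∘ₗ F)) hn hR hk
    (ρ := ρ) (fun j => by simpa [F, toEuclideanLin_single] using hDρ j) (fun j => by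
      have h : F (EuclideanSpace.single j 1) = WithLp.toLp 2 (D.col j) := by
        simp [F, toEuclideanLin_single]
      rw [LinearMap.smul_apply, LinearMap.comp_apply, h, norm_smul, mul_pow, Real.norm_eq_abs,
        sq_abs, inv_pow, mul_pow, hq2, inv_mul_le_iff₀ (by positivity)]
      linarith [hA j]) hx
  set y := netPoint R t
  have hδ : 2 * R ^ 2 * ρ / k ≤ (η / 10) ^ 2 := by
    rw [div_le_iff₀ hk0]
    linarith
  have h1 : ‖F (y - x)‖ ≤ η / 10 := by
    refine le_of_sq_le_sq ?_ (by positivity)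
    nlinarith [sq_nonneg ‖((2 * q)⁻¹ • (B ∘ₗ F)) (y - x)‖]
  have h2 : ‖B (F (y - x))‖ ≤ q * η / 5 := by
    have h : ‖((2 * q)⁻¹ • (B ∘ₗ F)) (y - x)‖ ≤ η / 10 := by
      refine le_of_sq_le_sq ?_ (by positivity)
      nlinarith [sq_nonneg ‖F (y - x)‖]
    rw [LinearMap.smul_apply, LinearMap.comp_apply, norm_smul, Real.norm_eq_abs,
      abs_of_pos (by positivity), inv_mul_le_iff₀ (by positivity)] at h
    linarith
  have h3 : q / 2 * ‖F y‖ ≤ ‖B (F y)‖ := by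
    refine le_of_sq_le_sq ?_ (norm_nonneg _)
    have := hnet t
    rw [← hq2] at this
    calc _ = q ^ 2 / 4 * ‖F y‖ ^ 2 := by ring
      _ ≤ _ := this
  have h4 : ‖F x‖ ≤ ‖F y‖ + ‖F (y - x)‖ := by
    have := norm_sub_le (F y) (F (y - x))
    rwa [← map_sub, sub_sub_cancel] at this
  have h5 : ‖B (F y)‖ ≤ ‖B (F x)‖ + ‖B (F (y - x))‖ := by
    have := norm_add_le (B (F x)) (B (F (y - x)))
    rwa [← map_add, ← map_add, add_sub_cancel] at this
  rw [toEuclideanLin_mul_apply]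
  -- The constants are tight: `(1/2)(1 - 1/10) - 1/5 = 1/4`.
  nlinarith

theorem hasStableNSP_of_forall_pos {m n s : ℕ} {γ : ℝ} (A : Matrix (Fin m) (Fin n) ℝ)
    (h : ∀ x ∈ violationSet n s γ, 0 < ‖Matrix.toEuclideanLin A x‖) : HasStableNSP A s γ := by
  intro x hx hx0 T hT
  by_contra! hle
  have hn : 0 < ‖x‖ := norm_pos_iff.2 hx0
  refine (h (‖x‖⁻¹ • x) ⟨⟨T, hT, ?_⟩, ?_⟩).ne' ?_
  · simp only [PiLp.smul_apply, smul_eq_mul, abs_mul, ← Finset.mul_sum]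
    have := mul_le_mul_of_nonneg_left hle (abs_nonneg ‖x‖⁻¹)
    linarith
  · rw [norm_smul, norm_inv, norm_norm, inv_mul_cancel₀ hn.ne']
  · simp [hx]

theorem exp_log_sqrt_two_mul_div {n s : ℕ} (hs : 1 ≤ s) (hsn : s ≤ n) :
    Real.exp (Real.log (Real.sqrt 2 * n / s)) = Real.sqrt 2 * n / s := by
  have : 1 ≤ n := hs.trans hsn
  exact Real.exp_log (by positivity)

/-- The factor `√2` keeps the logarithm away from 0 even for `n = s`: it is at least `(log 2)/2`. -/
theorem one_third_le_log {n s : ℕ} (hs : 1 ≤ s) (hsn : s ≤ n) :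
    1 / 3 ≤ Real.log (Real.sqrt 2 * n / s) := by
  have hs0 : (0 : ℝ) < s := by exact_mod_cast hs
  have h1 : Real.sqrt 2 ≤ Real.sqrt 2 * n / s := by
    rw [le_div_iff₀ hs0]
    gcongr
  have h2 := Real.log_le_log (by positivity) h1
  rw [Real.log_sqrt (by norm_num)] at h2
  have := Real.log_two_gt_d9
  linarith

/-- In the bound of `card_sym_le`, `e ≤ exp(3L)`, and `1 + 2n/k ≤ √2 n/s = exp(L)` because `k ≥ 800
s`. -/
theorem card_sym_le_exp {n s k : ℕ} {L : ℝ} (hs : 1 ≤ s) (hsn : s ≤ n) (hk : 800 * s ≤ k)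
    (hL : 1 / 3 ≤ L) (hLn : Real.exp L = Real.sqrt 2 * n / s) :
    (Fintype.card (Sym (Fin n × Bool) k) : ℝ) ≤ Real.exp (4 * L * k) := by
  have hs0 : (0 : ℝ) < s := by exact_mod_cast hs
  have hk0 : 0 < k := by omega
  have hk0' : (0 : ℝ) < k := by exact_mod_cast hk0
  have hks : (800 * s : ℝ) ≤ k := by exact_mod_cast hk
  have hns : (s : ℝ) ≤ n := by exact_mod_cast hsn
  refine (card_sym_le hk0).trans ?_
  have h : 4 * L * k = k * (3 * L + L) := by ring
  rw [h, Real.exp_nat_mul, Real.exp_add]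
  gcongr
  · linarith
  · rw [hLn, div_le_div_iff₀ hk0' hs0]
    simp only [Fintype.card_prod, Fintype.card_fin, Fintype.card_bool]
    push_cast
    have h2 : (1.41 : ℝ) ≤ Real.sqrt 2 := Real.le_sqrt_of_sq_le (by norm_num)
    calc (n * 2 + k) * (s : ℝ) = n * (2 * s) + k * s := by ring
      _ ≤ n * (k / 400) + k * n := by
        gcongr
        linarith
      _ ≤ 1.41 * n * k := by nlinarith
      _ ≤ Real.sqrt 2 * n * k := by gcongr

theorem cast_le_exp {n s : ℕ} {L : ℝ} (hs : 1 ≤ s) (hL : 1 / 3 ≤ L)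
    (hLn : Real.exp L = Real.sqrt 2 * n / s) : (n : ℝ) ≤ Real.exp (4 * (s * L)) := by
  have hs1 : (1 : ℝ) ≤ s := by exact_mod_cast hs
  have h2 : (1 : ℝ) ≤ Real.sqrt 2 := Real.le_sqrt_of_sq_le (by norm_num)
  have h3 : (n : ℝ) ≤ s * Real.exp L := by
    rw [hLn, mul_div_cancel₀ _ (by positivity)]
    nlinarith [Nat.cast_nonneg (α := ℝ) n]
  have h4 : (s : ℝ) ≤ Real.exp (3 * (s * L)) := by
    have := Real.add_one_le_exp (3 * (s * L))
    nlinarith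
  calc (n : ℝ) ≤ s * Real.exp L := h3
    _ ≤ Real.exp (3 * (s * L)) * Real.exp L := by gcongr
    _ ≤ _ := by
      rw [← Real.exp_add, Real.exp_le_exp]
      nlinarith

/-- With high probability the smallest norm of `Φ D x` over the violation set is of order `√m η`. -/
theorem one_sub_exp_le_measureReal {m d n s : ℕ} (hs : 1 ≤ s) (hsn : s ≤ n)
    {γ η ρ K L : ℝ} (hγ0 : 0 < γ) (hγ1 : γ < 1) (hη : 0 < η) (hρ : 0 < ρ)
    (D : Matrix (Fin d) (Fin n) ℝ) (hDη : η ≤ minNorm D (violationSet n s γ))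
    (hDρ : ∀ j : Fin n, ‖(WithLp.toLp 2 (D.col j) : EuclideanSpace ℝ (Fin d))‖ ^ 2 ≤ ρ)
    (hK : K * (γ ^ 2 * η ^ 2) = s * ρ) (hsK : s ≤ K) (hL : 1 / 3 ≤ L)
    (hLn : Real.exp L = Real.sqrt 2 * n / s) (hm : 7000000 * (K * L) ≤ m)
    {Ω : Type*} [MeasurableSpace Ω] (P : Measure Ω) [IsProbabilityMeasure P]
    (Φ : Ω → Matrix (Fin m) (Fin d) ℝ)
    (hΦlaw : ∀ i : Fin m, HasLaw
      (fun ω => (WithLp.toLp 2 ((Φ ω).row i) : EuclideanSpace ℝ (Fin d)))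
      (stdGaussian (EuclideanSpace ℝ (Fin d))) P)
    (hΦindep : iIndepFun
      (fun i ω => (WithLp.toLp 2 ((Φ ω).row i) : EuclideanSpace ℝ (Fin d))) P) :
    1 - Real.exp (-(m / 10)) ≤ P.real {ω | ∀ x ∈ violationSet n s γ,
      Real.sqrt m * η / 4 ≤ ‖Matrix.toEuclideanLin (Φ ω * D) x‖} := by
  have hs0 : (1 : ℝ) ≤ s := by exact_mod_cast hs
  have hKL : 1 / 3 ≤ K * L := by nlinarith
  have hmp : (0 : ℝ) < m := by linarith
  have hmp' : 0 < m := by exact_mod_cast hmp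
  -- With `R² = 4s/γ²`, this is the sample size for which `200 R² ρ ≤ k η²`.
  set k := ⌈800 * K⌉₊
  have hk1 : 800 * K ≤ k := Nat.le_ceil _
  have hk2 : (k : ℝ) ≤ 801 * K := by
    have := (Nat.ceil_lt_add_one (a := 800 * K) (by linarith)).le
    linarith
  have hks : 800 * s ≤ k := by
    have : (800 * s : ℝ) ≤ k := by linarith
    exact_mod_cast this
  have hcard := card_sym_le_exp hs hsn hks hL hLn
  set R := 2 * Real.sqrt s / γ
  have hR : 0 < R := by positivity
  have hR2 : R ^ 2 = 4 * s / γ ^ 2 := by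
    rw [div_pow, mul_pow, Real.sq_sqrt (by positivity)]
    norm_num
  have hkR : 200 * R ^ 2 * ρ ≤ k * η ^ 2 := by
    have h : 200 * R ^ 2 * ρ = 800 * K * η ^ 2 := by
      rw [hR2]
      field_simp
      linarith
    rw [h]
    gcongr
  let y : Sym (Fin n × Bool) k → EuclideanSpace ℝ (Fin d) :=
    fun t => Matrix.toEuclideanLin D (netPoint R t)
  let c : Fin n → EuclideanSpace ℝ (Fin d) := fun j => WithLp.toLp 2 (D.col j)
  let row : Fin m → Ω → EuclideanSpace ℝ (Fin d) := fun i ω => WithLp.toLp 2 ((Φ ω).row i)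
  let U : Sym (Fin n × Bool) k → Set Ω :=
    fun t => {ω | ∑ i, inner ℝ (row i ω) (y t) ^ 2 < m / 4 * ‖y t‖ ^ 2}
  let V : Fin n → Set Ω := fun j => {ω | 4 * m * ρ < ∑ i, inner ℝ (row i ω) (c j) ^ 2}
  set good := {ω | ∀ x ∈ violationSet n s γ,
      Real.sqrt m * η / 4 ≤ ‖Matrix.toEuclideanLin (Φ ω * D) x‖}
  have hcover : (Set.univ : Set Ω) ⊆ good ∪ ((⋃ t, U t) ∪ ⋃ j, V j) := by
    intro ω _
    by_contra hω
    simp only [Set.mem_union, Set.mem_iUnion, not_or, not_exists] at hω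
    obtain ⟨h1, h2, h3⟩ := hω
    refine h1 fun x hx => sqrt_mul_le_norm_of_net (Φ ω) D (hs.trans hsn) hmp' (by omega) hR hη hkR
      hDρ (fun j => ?_) (fun t => ?_) (sum_abs_le_of_mem_violationSet hγ0 hγ1 hx)
      (hDη.trans (minNorm_le D hx))
    · rw [norm_sq_toEuclideanLin]
      exact not_lt.1 (h3 j)
    · rw [norm_sq_toEuclideanLin (Φ ω)]
      exact not_lt.1 (h2 t)
  have hU : P.real (⋃ t, U t) ≤ Real.exp (-(m / 5)) := by
    calc P.real (⋃ t, U t) ≤ ∑ t, P.real (U t) := measureReal_iUnion_fintype_le _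
      _ ≤ ∑ t : Sym (Fin n × Bool) k, Real.exp (-(3 / 10 * m)) := by
        gcongr with t
        exact measureReal_sum_inner_sq_lt_le hΦlaw hΦindep (y t)
      _ = Fintype.card (Sym (Fin n × Bool) k) * Real.exp (-(3 / 10 * m)) := by simp
      _ ≤ Real.exp (4 * L * k) * Real.exp (-(3 / 10 * m)) := by gcongr
      _ ≤ _ := by
        rw [← Real.exp_add, Real.exp_le_exp]
        -- `4Lk ≤ 3204 KL`, far below `m/10`.
        nlinarith
  have hV : P.real (⋃ j, V j) ≤ Real.exp (-(m / 5)) := by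
    calc P.real (⋃ j, V j) ≤ ∑ j, P.real (V j) := measureReal_iUnion_fintype_le _
      _ ≤ ∑ j : Fin n, Real.exp (-(7 / 10 * m)) := by
        gcongr with j
        exact measureReal_lt_sum_inner_sq_le hΦlaw hΦindep (c j) hρ (hDρ j)
      _ = n * Real.exp (-(7 / 10 * m)) := by simp
      _ ≤ Real.exp (4 * (s * L)) * Real.exp (-(7 / 10 * m)) := by
        gcongr
        exact cast_le_exp hs hL hLn
      _ ≤ _ := by
        rw [← Real.exp_add, Real.exp_le_exp]
        have : s * L ≤ K * L := by gcongr
        linarith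
  have htwo : 2 * Real.exp (-(m / 5)) ≤ Real.exp (-(m / 10)) := by
    have h2 : 2 ≤ Real.exp (m / 10) := by
      have := Real.add_one_le_exp (m / 10 : ℝ)
      linarith
    calc _ ≤ Real.exp (m / 10) * Real.exp (-(m / 5)) := by gcongr
      _ = _ := by
        rw [← Real.exp_add]
        ring_nf
  have htot : (1 : ℝ) ≤ P.real good + (P.real (⋃ t, U t) + P.real (⋃ j, V j)) := by
    calc (1 : ℝ) = P.real Set.univ := by simp
      _ ≤ P.real (good ∪ ((⋃ t, U t) ∪ ⋃ j, V j)) := measureReal_mono hcover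
      _ ≤ P.real good + P.real ((⋃ t, U t) ∪ ⋃ j, V j) := measureReal_union_le _ _
      _ ≤ _ := by
        gcongr
        exact measureReal_union_le _ _
  linarith

end StableNSP

/-! ### Assembly and constants. -/

theorem mainTheorem7 {m d n s : ℕ} (hs : 1 ≤ s) (hsn : s ≤ n)
    {γ η ρ : ℝ} (hγ0 : 0 < γ) (hγ1 : γ < 1) (hη : 0 < η)
    (D : Matrix (Fin d) (Fin n) ℝ)
    (hD : StableNSP.HasStableNSP D s γ)
    (hDη : η ≤ StableNSP.minNorm D (StableNSP.violationSet n s γ))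
    (hDρ : ∀ j : Fin n, ‖(WithLp.toLp 2 (D.col j) : EuclideanSpace ℝ (Fin d))‖ ^ 2 ≤ ρ)
    (hm : 9 * 2 ^ 15 * Real.pi ^ 3 / η ^ 2 * (ρ / γ ^ 2) * s *
      Real.log (Real.sqrt 2 * n / s) ≤ (m : ℝ))
    {Ω : Type*} [MeasurableSpace Ω] (P : MeasureTheory.Measure Ω)
    [MeasureTheory.IsProbabilityMeasure P]
    (Φ : Ω → Matrix (Fin m) (Fin d) ℝ)
    (hΦlaw : ∀ i : Fin m, ProbabilityTheory.HasLaw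
      (fun ω => (WithLp.toLp 2 ((Φ ω).row i) : EuclideanSpace ℝ (Fin d)))
      (ProbabilityTheory.stdGaussian (EuclideanSpace ℝ (Fin d))) P)
    (hΦindep : ProbabilityTheory.iIndepFun
      (fun i ω => (WithLp.toLp 2 ((Φ ω).row i) : EuclideanSpace ℝ (Fin d))) P) :
    1 - Real.exp (-((m : ℝ) * (1 / (4 ^ 5 * Real.pi ^ 2)))) ≤
      P.real {ω | StableNSP.HasStableNSP (Φ ω * D) s γ ∧
        StableNSP.gaussianWidth (Matrix.toEuclideanLin D '' StableNSP.violationSet n s γ) ≤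
          StableNSP.minNorm (Φ ω * D) (StableNSP.violationSet n s γ)} := by
  have hn : 0 < n := hs.trans hsn
  have hs1 : (1 : ℝ) ≤ s := by exact_mod_cast hs
  have hLn := StableNSP.exp_log_sqrt_two_mul_div hs hsn
  have hL := StableNSP.one_third_le_log hs hsn
  set L := Real.log (Real.sqrt 2 * n / s)
  -- A coordinate vector lies in `S_γ`, so `η` is at most the norm of a column. This gives `ρ > 0`
  -- and `s ≤ K`.
  have hηρ : η ^ 2 ≤ ρ := by
    let j : Fin n := ⟨0, hn⟩
    have hj : EuclideanSpace.single j (1 : ℝ) ∈ StableNSP.violationSet n s γ := by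
      refine ⟨⟨{j}, by simpa using hs, ?_⟩, by simp⟩
      have h : ∑ i ∈ ({j} : Finset (Fin n))ᶜ, |(EuclideanSpace.single j (1 : ℝ)) i| = 0 := by
        refine Finset.sum_eq_zero fun i hi => ?_
        have : i ≠ j := by simpa using hi
        simp [this]
      rw [h]
      simp
    have h := hDη.trans (StableNSP.minNorm_le D hj)
    rw [StableNSP.toEuclideanLin_single, one_smul] at h
    exact (pow_le_pow_left₀ hη.le h 2).trans (hDρ j)
  have hρ : 0 < ρ := lt_of_lt_of_le (by positivity) hηρ
  set K := s * ρ / (γ ^ 2 * η ^ 2)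
  have hK : K * (γ ^ 2 * η ^ 2) = s * ρ := div_mul_cancel₀ _ (by positivity)
  have hsK : s ≤ K := by
    rw [le_div_iff₀ (by positivity)]
    have : γ ^ 2 * η ^ 2 ≤ 1 * ρ := by
      gcongr
      nlinarith
    nlinarith
  have hKL : 1 / 3 ≤ K * L := by nlinarith
  -- `9 · 2^15 · 27 > 7 · 10^6`.
  have hmK : 7000000 * (K * L) ≤ m := by
    have hpi : 27 ≤ Real.pi ^ 3 := by
      calc (27 : ℝ) = 3 ^ 3 := by norm_num
        _ ≤ _ := by
          gcongr
          exact Real.pi_gt_three.le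
    have h : 9 * 2 ^ 15 * Real.pi ^ 3 / η ^ 2 * (ρ / γ ^ 2) * s * L =
        9 * 2 ^ 15 * Real.pi ^ 3 * (K * L) := by
      simp only [K]
      field_simp
    rw [h] at hm
    nlinarith
  have hm0 : (0 : ℝ) < m := by linarith
  -- The bound `13 √(ρsL)/γ` equals `13 η √(KL)`, and `(4 · 13)² = 2704` is well below `7 · 10^6`.
  have hwidth : StableNSP.gaussianWidth (Matrix.toEuclideanLin D '' StableNSP.violationSet n s γ) ≤
      Real.sqrt m * η / 4 := by
    refine (StableNSP.gaussianWidth_le_sqrt hs hsn hγ0 hγ1 hρ hL ?_ D hDρ).trans ?_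
    · have h2 : (1 : ℝ) ≤ Real.sqrt 2 := Real.le_sqrt_of_sq_le (by norm_num)
      rw [Real.exp_neg, hLn, inv_mul_le_iff₀ (by positivity), div_mul_cancel₀ _ (by positivity)]
      nlinarith [Nat.cast_nonneg (α := ℝ) n]
    · refine le_of_sq_le_sq ?_ (by positivity)
      rw [div_pow, mul_pow, div_pow, mul_pow, Real.sq_sqrt (by positivity),
        Real.sq_sqrt hm0.le, div_le_iff₀ (by positivity)]
      have h : ρ * s * L = K * L * (γ ^ 2 * η ^ 2) := by linear_combination -L * hK
      rw [h]
      have : 0 < γ ^ 2 * η ^ 2 := by positivity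
      nlinarith
  have hexp : Real.exp (-(m / 10)) ≤ Real.exp (-((m : ℝ) * (1 / (4 ^ 5 * Real.pi ^ 2)))) := by
    rw [Real.exp_le_exp, neg_le_neg_iff, div_eq_mul_one_div (m : ℝ) 10]
    gcongr
    nlinarith [Real.pi_gt_three]
  refine le_trans ?_ ((StableNSP.one_sub_exp_le_measureReal hs hsn hγ0 hγ1 hη hρ D hDη hDρ hK hsK
    hL hLn hmK P Φ hΦlaw hΦindep).trans (MeasureTheory.measureReal_mono fun ω hω => ⟨?_, ?_⟩))
  · linarith
  · exact StableNSP.hasStableNSP_of_forall_pos _ fun x hx =>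
      lt_of_lt_of_le (by positivity) (hω x hx)
  · have : Nonempty (StableNSP.violationSet n s γ) :=
      (StableNSP.violationSet_nonempty γ hs hn).to_subtype
    exact le_ciInf fun x => hwidth.trans (hω x x.2)
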